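/- Setting. Fix $n\ge 0$, $k\ge 2$, $d_p\ge n$ and a continuous activation function $\varphi:\mathbb R\to\mathbb R$ that is not a polynomial. An order-$k$ tensor is an $X\in\mathbb R^{n^k\times d}$, i.e. a feature vector $X_{\mathbf i}\in\mathbb R^d$ for each $\mathbf i\in[n]^k$; permutations $\pi\in S_n$ act by $(\pi\cdot X)_{\mathbf i}=X_{\pi^{-1}(\mathbf i)}$. Graphs with node and edge features are order-2 tensors, and two of them are isomorphic if they lie in one $S_n$-orbit. A representation of graphs by order-$k$ tensors is a continuous, injective, $S_n$-equivariant map $\rho:\mathbb R^{n^2\times d}\to\mathbb R^{n^k\times d'}$ (for $k=2$ for instance the identity; in general for instance $\rho(A)_{\mathbf i}=(A_{i_a,i_b})_{a,b\in[k]}$). An order-$k$ Transformer on node and type identifiers receives an order-$k$ tensor $X$ and node identifiers $P\in\mathbb R^{n\times d_p}$ with orthonormal rows. It forms the $n^k$ tokens $[X_{\mathbf i},P_{i_1},\dots,P_{i_k},E^{\gamma}]$, where $\gamma$ is the $S_n$-orbit of $\mathbf i$ and the type identifiers $E^\gamma\in\mathbb R^{d_e}$ are trainable; applies a trainable linear projection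 to $\mathbb R^{d_{\mathcal T}}$; applies $T\ge1$ Transformer layers $X\mapsto H+\mathrm{MLP}(H)$ with $H=X+\mathrm{MSA}(X)$, where $\mathrm{MSA}$ is multihead softmax self-attention (with query and key biases) and $\mathrm{MLP}$ is a tokenwise perceptron with one hidden layer and activation $\varphi$; then sums over all tokens and applies a further such perceptron with output in $\mathbb R$. All weights and all sizes other than $n,k,d_p$ and the number of input channels are free parameters, which do not depend on $P$. Write $N(X,P)$ for the output. The $k$-WL test colours the $k$-tuples of nodes. The initial colour of $\mathbf i$ in $A$ is its isomorphism type: which entries $i_a,i_b$ coincide, together with all $A_{i_a,i_b}$. In each round the new colour of $\mathbf i$ consists of its old colour and, for each position $a\in[k]$, the multiset of the old colours of the tuples obtained from $\mathbf i$ by replacing $i_a$ by each of the $n$ nodes. Two graphs are distinguished if after some round the multisets of colours of all $k$-tuples differ. A message-passing GNN in the framework of Gilmer et al. acts on a simple graph $G$ on $[n]$ with node features $x_v\in\mathbb R^c$ and edge features $e_{vw}\in\mathbb R^{c'}$ by $h_v^{0}=I(x_v)$, $m_v^{t+1}=\sum_{w\in N(v)}M_t(h_v^t,h_w^t,e_{vw})$,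 $h_v^{t+1}=U_t(h_v^t,m_v^{t+1})$ for $t<T$, with output $R(\{h_v^T\}_v)\in\mathbb R$, where $I,M_t,U_t,R$ are arbitrary continuous functions between Euclidean spaces and $R$ is invariant under permutations of the nodes. Such a $G$ is turned into the order-2 tensor that carries the adjacency indicator, the node features on the diagonal and the edge features at the edges (zeros elsewhere), and then into an order-$k$ tensor $\rho(G)$ by any representation $\rho$ as above. Say that Transformers approximate a function $f$ of such graphs if for all $r$ and $\varepsilon>0$ there is a single Transformer $N$ with $|N(\rho(G),P)-f(G)|\le\varepsilon$ for all $G$ whose order-2 tensor has entries bounded by $r$ in absolute value and all orthonormal $P$. Corollary 2. (1) Transformers are at least as powerful as the $k$-WL graph isomorphism test: for every representation $\rho$, every finite set $S$ of graphs (order-2 tensors) on $n$ nodes and every $\varepsilon>0$ there is one Transformer $N$ such that for all $A,B\in S$ and all orthonormal node identifiers $P,Q$: if $k$-WL distinguishes $A$ and $B$, then $|N(\rho(A),P)-N(\rho(B),Q)|\ge 1$; and if $A$ and $B$ are isomorphic, then $|N(\rho(A),P)-N(\rho(B),Q)|\le\varepsilon$. (2) Transformers are more expressive than all message-passing GNNs: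 for all $c,c'$ and every representation $\rho$, Transformers approximate the function computed by any message-passing GNN; and if $n\ge6$, there is an isomorphism-invariant function $f$ of featured graphs on $n$ nodes that Transformers approximate, while for some graphs $G,G'$ with $f(G)\ne f(G')$ every message-passing GNN gives the same output on $G$ and $G'$ (so $f$ is not approximated by message-passing GNNs). -/

import Mathlib

open Matrix

namespace GraphTransformer

/-! ## Order-`k` tensors and node permutations -/

/-- Order-`k` tensors on `n` nodes: a feature vector (with channels `δ`) for every multi-index
`(i₁, …, iₖ) ∈ [n]ᵏ`. A graph with real node and edge features is an order-`2` tensor: the features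
of node `v` sit at `(v, v)`, the features of the pair `(u, v)` (adjacency included) at `(u, v)`. -/
abbrev Tensor (n k : ℕ) (δ : Type) : Type := (Fin k → Fin n) → δ → ℝ

/-- The action `(π · X)_i = X_{π⁻¹(i)}` of node permutations on tensors. -/
def permute {n k : ℕ} {δ : Type} (π : Equiv.Perm (Fin n)) (X : Tensor n k δ) : Tensor n k δ :=
  fun i => X (fun a => π.symm (i a))

/-- Two tensors represent isomorphic (hyper)graphs. -/
def TensorIso {n k : ℕ} {δ : Type} (X Y : Tensor n k δ) : Prop :=
  ∃ π : Equiv.Perm (Fin n), Y = permute π X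

/-- A way to represent graphs (order-`2` tensors) as order-`k` tensors: continuous, lossless, and
compatible with renumbering the nodes. For `k = 2` the identity is one; for every `k ≥ 2` the map
that lists the features of all pairs of entries of a multi-index, `i ↦ (A_{i_a, i_b})_{a, b}`,
is one. -/
structure IsTensorRepresentation {n k : ℕ} {δ δ' : Type}
    (rep : Tensor n 2 δ → Tensor n k δ') : Prop where
  continuous : Continuous rep
  injective : Function.Injective rep
  equivariant : ∀ (π : Equiv.Perm (Fin n)) (A : Tensor n 2 δ), rep (permute π A) = permute π (rep A)

/-! ## The Transformer on node and type identifiers -/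

/-- A two-layer perceptron `ℝᴰ → ℝᴰ'` with `F` hidden units. -/
structure MLP (D F D' : ℕ) where
  W₁ : Matrix (Fin D) (Fin F) ℝ
  b₁ : Fin F → ℝ
  W₂ : Matrix (Fin F) (Fin D') ℝ
  b₂ : Fin D' → ℝ

/-- The function computed by a perceptron with activation function `φ`. -/
def MLP.eval {D F D' : ℕ} (φ : ℝ → ℝ) (m : MLP D F D') (x : Fin D → ℝ) : Fin D' → ℝ :=
  (fun j => φ ((x ᵥ* m.W₁ + m.b₁) j)) ᵥ* m.W₂ + m.b₂

/-- The parameters of one attention head. -/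
structure AttentionHead (D dH dv : ℕ) where
  wQ : Matrix (Fin D) (Fin dH) ℝ
  bQ : Fin dH → ℝ
  wK : Matrix (Fin D) (Fin dH) ℝ
  bK : Fin dH → ℝ
  wV : Matrix (Fin D) (Fin dv) ℝ
  wO : Matrix (Fin dv) (Fin D) ℝ

section Attention

variable {D dH dv : ℕ} {ι : Type} [Fintype ι]

/-- Scaled dot product of the `i`-th query and the `j`-th key. -/
noncomputable def AttentionHead.score (h : AttentionHead D dH dv) (X : Matrix ι (Fin D) ℝ)
    (i j : ι) : ℝ :=
  ((X i ᵥ* h.wQ + h.bQ) ⬝ᵥ (X j ᵥ* h.wK + h.bK)) / Real.sqrt dH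

/-- Attention coefficients: the row-wise softmax of the scores. -/
noncomputable def AttentionHead.coeff (h : AttentionHead D dH dv) (X : Matrix ι (Fin D) ℝ)
    (i j : ι) : ℝ :=
  Real.exp (h.score X i j) / ∑ l, Real.exp (h.score X i l)

/-- Multihead self-attention. -/
noncomputable def msa {H : ℕ} (heads : Fin H → AttentionHead D dH dv) (X : Matrix ι (Fin D) ℝ) :
    Matrix ι (Fin D) ℝ :=
  fun i => ∑ h, ∑ j, (heads h).coeff X i j • ((X j ᵥ* (heads h).wV) ᵥ* (heads h).wO)

end Attention

/-- The parameters of one Transformer layer. -/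
structure TransformerLayer (D H dH dv dF : ℕ) where
  heads : Fin H → AttentionHead D dH dv
  mlp : MLP D dF D

/-- A Transformer layer: `H = X + MSA(X)`, followed by the tokenwise `H + MLP(H)`. -/
noncomputable def TransformerLayer.eval {D H dH dv dF : ℕ} {ι : Type} [Fintype ι] (φ : ℝ → ℝ)
    (L : TransformerLayer D H dH dv dF) (X : Matrix ι (Fin D) ℝ) : Matrix ι (Fin D) ℝ :=
  fun i => (X + msa L.heads X) i + L.mlp.eval φ ((X + msa L.heads X) i)

/-- The order-`k` equivalence classes `[n]ᵏ / ∼`: orbits of multi-indices under node permutations,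
which act entrywise. -/
abbrev IndexClass (n k : ℕ) : Type :=
  MulAction.orbitRel.Quotient (Equiv.Perm (Fin n)) (Fin k → Fin n)

/-- Node identifiers: `n` orthonormal row vectors. -/
def IsNodeIdentifier {n dp : ℕ} (P : Matrix (Fin n) (Fin dp) ℝ) : Prop :=
  P * Pᵀ = 1

/-- The augmented token `[X_i, P_{i₁}, …, P_{iₖ}, E^γ]`, where `γ` is the class of `i`. -/
def augment {n k d dp de : ℕ} (X : Tensor n k (Fin d)) (P : Matrix (Fin n) (Fin dp) ℝ)
    (E : IndexClass n k → Fin de → ℝ) :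
    Matrix (Fin k → Fin n) (Fin d ⊕ (Fin k × Fin dp) ⊕ Fin de) ℝ :=
  fun i => Sum.elim (X i) (Sum.elim (fun q => P (i q.1) q.2) (E (Quotient.mk _ i)))

/-- The sizes and trainable parameters of an order-`k` graph Transformer for inputs with `d`
channels on `n` nodes and node identifiers in `ℝ^dp`: type identifiers `E`, input projection `wIn`,
a stack of Transformer layers (first one first), and the perceptron that follows sum-pooling. -/
structure Transformer (n k d dp : ℕ) where
  (de dT H dH dv dF dOut : ℕ)
  H_pos : 0 < H
  dH_pos : 0 < dH
  E : IndexClass n k → Fin de → ℝ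
  wIn : Matrix (Fin d ⊕ (Fin k × Fin dp) ⊕ Fin de) (Fin dT) ℝ
  layers : List (TransformerLayer dT H dH dv dF)
  layers_ne : layers ≠ []
  readout : MLP dT dOut 1

/-- The output of the Transformer on the tensor `X` with node identifiers `P`. -/
noncomputable def Transformer.eval {n k d dp : ℕ} (φ : ℝ → ℝ) (N : Transformer n k d dp)
    (X : Tensor n k (Fin d)) (P : Matrix (Fin n) (Fin dp) ℝ) : ℝ :=
  N.readout.eval φ
    (∑ i, N.layers.foldl (fun Z L => L.eval φ Z) (augment X P N.E * N.wIn) i) 0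

/-! ## The `k`-dimensional Weisfeiler-Leman test -/

/-- Colours after `t` rounds of `k`-WL. A new colour consists of the old colour and, for every
position of the tuple, the multiset of old colours found when that entry is replaced. -/
def WLColor (k : ℕ) (δ : Type) : ℕ → Type
  | 0 => Fin k → Fin k → Prop × (δ → ℝ)
  | t + 1 => WLColor k δ t × (Fin k → Multiset (WLColor k δ t))

/-- The `k`-WL colouring of the `k`-tuples of nodes of the graph `A`. The initial colour is the
isomorphism type: which entries coincide, and the features of all pairs of entries. -/
def wlColor (k : ℕ) {n : ℕ} {δ : Type} (A : Tensor n 2 δ) : (t : ℕ) → (Fin k → Fin n) → WLColor k δ t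
  | 0 => fun i a b => (i a = i b, A ![i a, i b])
  | t + 1 => fun i =>
      (wlColor k A t i,
        fun a => Finset.univ.val.map (fun v : Fin n => wlColor k A t (Function.update i a v)))

/-- The `k`-WL test tells two graphs apart: after some round their colour histograms differ. -/
def WLDistinguishes (k : ℕ) {n : ℕ} {δ : Type} (A B : Tensor n 2 δ) : Prop :=
  ∃ t : ℕ, (Finset.univ.val.map (wlColor k A t) : Multiset (WLColor k δ t)) ≠
    Finset.univ.val.map (wlColor k B t)

/-! ## Message-passing graph neural networks -/

/-- A graph on `n` nodes with node features in `ℝᶜ` and edge features in `ℝᶜ'` (only the values of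
`edge` at adjacent pairs matter). -/
structure FeaturedGraph (n c c' : ℕ) where
  graph : SimpleGraph (Fin n)
  node : Fin n → Fin c → ℝ
  edge : Fin n → Fin n → Fin c' → ℝ

/-- Renumbering the nodes. -/
def FeaturedGraph.relabel {n c c' : ℕ} (π : Equiv.Perm (Fin n)) (G : FeaturedGraph n c c') :
    FeaturedGraph n c c' where
  graph := G.graph.comap π.symm
  node := fun v => G.node (π.symm v)
  edge := fun u v => G.edge (π.symm u) (π.symm v)

open Classical in
/-- The dense order-`2` tensor of a graph: adjacency indicator, node features on the diagonal,
edge features at the edges, and zeros elsewhere. -/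
noncomputable def FeaturedGraph.toTensor {n c c' : ℕ} (G : FeaturedGraph n c c') :
    Tensor n 2 (Unit ⊕ Fin c ⊕ Fin c') :=
  fun i => Sum.elim (fun _ => if G.graph.Adj (i 0) (i 1) then 1 else 0)
    (Sum.elim (fun a => if i 0 = i 1 then G.node (i 0) a else 0)
      (fun a => if G.graph.Adj (i 0) (i 1) then G.edge (i 0) (i 1) a else 0))

/-- A message-passing neural network: message functions `M t`, update functions `U t` and a readout
`R` that does not depend on the order of the nodes. -/
structure MPNN (n c c' : ℕ) where
  /-- number of message-passing rounds -/
  T : ℕ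
  /-- dimensions of the hidden states -/
  hid : ℕ → ℕ
  /-- dimensions of the messages -/
  msg : ℕ → ℕ
  /-- initial hidden state, a function of the node features -/
  embed : (Fin c → ℝ) → Fin (hid 0) → ℝ
  M : ∀ t, (Fin (hid t) → ℝ) → (Fin (hid t) → ℝ) → (Fin c' → ℝ) → Fin (msg t) → ℝ
  U : ∀ t, (Fin (hid t) → ℝ) → (Fin (msg t) → ℝ) → Fin (hid (t + 1)) → ℝ
  R : (Fin n → Fin (hid T) → ℝ) → ℝ
  continuous_embed : Continuous embed
  continuous_M : ∀ t, Continuous fun p : (Fin (hid t) → ℝ) × (Fin (hid t) → ℝ) × (Fin c' → ℝ) =>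
    M t p.1 p.2.1 p.2.2
  continuous_U : ∀ t, Continuous fun p : (Fin (hid t) → ℝ) × (Fin (msg t) → ℝ) => U t p.1 p.2
  continuous_R : Continuous R
  R_perm : ∀ (π : Equiv.Perm (Fin n)) (h : Fin n → Fin (hid T) → ℝ), R (fun v => h (π v)) = R h

open Classical in
/-- Hidden states: `h_v^{t+1} = U_t (h_v^t, ∑_{w ∈ N(v)} M_t (h_v^t, h_w^t, e_{vw}))`. -/
noncomputable def MPNN.state {n c c' : ℕ} (N : MPNN n c c') (G : FeaturedGraph n c c') :
    (t : ℕ) → Fin n → Fin (N.hid t) → ℝ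
  | 0 => fun v => N.embed (G.node v)
  | t + 1 => fun v =>
      N.U t (N.state G t v)
        (∑ w with G.graph.Adj v w, N.M t (N.state G t v) (N.state G t w) (G.edge v w))

/-- The output of a message-passing network: the readout of the final hidden states. -/
noncomputable def MPNN.eval {n c c' : ℕ} (N : MPNN n c c') (G : FeaturedGraph n c c') : ℝ :=
  N.R (N.state G N.T)

/-- Transformers with activation `φ` approximate the function `f` of featured graphs, given through
the order-`k` representation `rep`, to arbitrary precision: uniformly over all graphs with bounded
features and over all choices of orthonormal node identifiers in `ℝ^dp`. -/
def TransformerApproximates {n k c c' d : ℕ} (φ : ℝ → ℝ) (dp : ℕ)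
    (rep : Tensor n 2 (Unit ⊕ Fin c ⊕ Fin c') → Tensor n k (Fin d))
    (f : FeaturedGraph n c c' → ℝ) : Prop :=
  ∀ r : ℝ, ∀ ε > 0, ∃ N : Transformer n k d dp,
    ∀ G : FeaturedGraph n c c', (∀ i a, |G.toTensor i a| ≤ r) →
      ∀ P : Matrix (Fin n) (Fin dp) ℝ, IsNodeIdentifier P →
        |N.eval φ (rep G.toTensor) P - f G| ≤ ε

end GraphTransformer

/-!
The theorem follows from a universality property: Transformers approximate every continuous
function of order-`k` tensors that is constant on the orbits of node permutations, uniformly over a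
compact family of tensors and over all node identifiers (`exists_transformer_approx`).

Attention is not needed for this. With vanishing value matrices, a Transformer of one layer pools a
perceptron over all tokens and applies a second perceptron (`exists_transformer_eval_eq`). Since
orthonormal node identifiers are pairwise distinct, the multiset of tokens determines the tensor up
to a node permutation (`tensorIso_of_token_sum_eq`), so an invariant function of the tensor is a
function of the pooled hidden units. What remains is a universal approximation theorem that does not
require the available features to separate points (`mem_of_ridge_mem`); it is used once for the
perceptron on the tokens and once for the readout.

The approximation theorem is that of Leshno, Lin, Pinkus and Schocken for continuous non-polynomial
activations. A closed space `V` of continuous functions that contains all `φ (s · l + b)` contains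
the same functions with `φ` mollified, hence their derivatives in the slope `s`, which at `s = 0`
are multiples of the powers of `l`; hence it contains `exp l`. When `l` runs through a linear space,
the functions `exp l` span an algebra, and the Stone-Weierstrass theorem applies.

For the comparison with `k`-WL, a continuous function on a finite set of graphs may number the
isomorphism classes, and `k`-WL distinguishes only non-isomorphic graphs. A message-passing network
extends to a continuous invariant of order-`2` tensors by using the adjacency channel as edge
weights (`MPNN.tensorState`), so that universality applies to it. Finally, the number of closed
walks of length three is a polynomial invariant that is positive on two disjoint triangles and zero
on a hexagon, while both graphs look the same to every message-passing network
(`MPNN.eval_hexagon_eq`).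
-/

/-! ### Universal approximation by a non-polynomial activation -/

section UniversalApproximation

open MeasureTheory Filter Topology
open scoped Convolution ContDiff

/-- A smooth function whose `m`-th derivative vanishes is a polynomial of degree less than `m`. -/
theorem exists_polynomial_of_iteratedDeriv_eq_zero (m : ℕ) (g : ℝ → ℝ) (hg : ContDiff ℝ ∞ g)
    (h : ∀ x, iteratedDeriv m g x = 0) :
    ∃ p ∈ Polynomial.degreeLT ℝ m, ∀ x, g x = p.eval x := by
  induction m generalizing g with
  | zero => exact ⟨0, Submodule.zero_mem _, by simpa using h⟩
  | succ m ih =>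
    obtain ⟨p, hp, hgp⟩ := ih (deriv g) (contDiff_infty_iff_deriv.1 hg).2
      (fun x => by rw [← iteratedDeriv_succ']; exact h x)
    have hpm : ∀ i, m ≤ i → p.coeff i = 0 := fun i hi =>
      Polynomial.coeff_eq_zero_of_degree_lt
        ((Polynomial.mem_degreeLT.1 hp).trans_le (by exact_mod_cast hi))
    -- `q` is the antiderivative of `p` without constant term
    set q : Polynomial ℝ :=
      ∑ i ∈ Finset.range m, Polynomial.monomial (i + 1) (p.coeff i / ((i : ℝ) + 1)) with hq
    have hqd : q.derivative = p := by
      ext i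
      rw [Polynomial.coeff_derivative, hq, Polynomial.finsetSum_coeff]
      simp only [Polynomial.coeff_monomial, Nat.add_right_cancel_iff, Finset.sum_ite_eq',
        Finset.mem_range]
      split_ifs with hi
      · field_simp
      · rw [hpm i (not_lt.1 hi), zero_mul]
    have hqm : q ∈ Polynomial.degreeLT ℝ (m + 1) := by
      refine Submodule.sum_mem _ fun i hi => Polynomial.mem_degreeLT.2 ?_
      refine (Polynomial.degree_monomial_le _ _).trans_lt ?_
      exact_mod_cast Nat.succ_lt_succ (Finset.mem_range.1 hi)
    have hconst : ∀ x y, g x - q.eval x = g y - q.eval y := by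
      have hd : Differentiable ℝ g := (contDiff_infty_iff_deriv.1 hg).1
      refine is_const_of_deriv_eq_zero (hd.sub q.differentiable) fun x => ?_
      have := ((hd x).hasDerivAt.sub (q.hasDerivAt x)).deriv
      refine this.trans ?_
      rw [hqd, hgp, sub_self]
    refine ⟨q + Polynomial.C (g 0 - q.eval 0), Submodule.add_mem _ hqm ?_, fun x => ?_⟩
    · refine Polynomial.mem_degreeLT.2 (Polynomial.degree_C_le.trans_lt ?_)
      exact_mod_cast Nat.succ_pos m
    · rw [Polynomial.eval_add, Polynomial.eval_C, hconst 0 x]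
      ring

/-- If a continuous `φ` is not a polynomial then, for each order `m`, some mollification of `φ` has
a non-zero `m`-th derivative somewhere: otherwise `φ` is a pointwise limit of polynomials of degree
less than `m`. -/
theorem exists_mollifier_iteratedDeriv_ne_zero {φ : ℝ → ℝ} (hφ : Continuous φ)
    (hφ_poly : ¬ ∃ p : Polynomial ℝ, ∀ x, φ x = p.eval x) (m : ℕ) :
    ∃ (ψ : ContDiffBump (0 : ℝ)) (b : ℝ),
      iteratedDeriv m (ψ.normed volume ⋆[ContinuousLinearMap.lsmul ℝ ℝ, volume] φ) b ≠ 0 := by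
  by_contra! hzero
  -- Polynomials of degree `< m` form a finite-dimensional, hence pointwise closed, space.
  let ev : Polynomial ℝ →ₗ[ℝ] (ℝ → ℝ) := LinearMap.pi fun x => Polynomial.leval x
  let W : Submodule ℝ (ℝ → ℝ) := (Polynomial.degreeLT ℝ m).map ev
  have : FiniteDimensional ℝ (Polynomial.degreeLT ℝ m) :=
    (Polynomial.degreeLTEquiv ℝ m).symm.finiteDimensional
  have hW : IsClosed (W : Set (ℝ → ℝ)) := W.closed_of_finiteDimensional
  let ψ : ℕ → ContDiffBump (0 : ℝ) := fun j =>
    ⟨1 / ((j : ℝ) + 1) / 2, 1 / ((j : ℝ) + 1), by positivity, half_lt_self (by positivity)⟩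
  have hψ : Tendsto (fun j => (ψ j).rOut) atTop (𝓝 0) := tendsto_one_div_add_atTop_nhds_zero_nat
  have hmem : φ ∈ (W : Set (ℝ → ℝ)) := by
    refine hW.mem_of_tendsto (tendsto_pi_nhds.2 fun x =>
      ContDiffBump.convolution_tendsto_right_of_continuous (μ := volume) hψ hφ x)
      (Eventually.of_forall fun j => ?_)
    obtain ⟨p, hp, hp'⟩ := exists_polynomial_of_iteratedDeriv_eq_zero m _
      ((ψ j).hasCompactSupport_normed.contDiff_convolution_left _ (ψ j).contDiff_normed
        hφ.locallyIntegrable) (hzero (ψ j))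
    exact ⟨p, hp, funext fun x => (hp' x).symm⟩
  obtain ⟨p, -, hp⟩ := hmem
  exact hφ_poly ⟨p, fun x => (congrFun hp x).symm⟩

/-- The integral of a function with values in a closed subspace lies in that subspace. -/
theorem integral_mem_of_forall_mem {E : Type*} [NormedAddCommGroup E] [NormedSpace ℝ E]
    [CompleteSpace E] {V : Submodule ℝ E} (hV : IsClosed (V : Set E)) {F : ℝ → E}
    (hF : Continuous F) (hFi : Integrable F) (h : ∀ t, F t ∈ V) : ∫ t, F t ∈ V := by
  have : CompleteSpace V := hV.completeSpace_coe
  have hG : Integrable fun t => (⟨F t, h t⟩ : V) :=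
    hFi.mono (hF.subtype_mk h).aestronglyMeasurable (Eventually.of_forall fun _ => le_rfl)
  have := V.subtypeL.integral_comp_comm hG
  exact this ▸ Subtype.coe_prop _

variable {K : Type*} [TopologicalSpace K]

/-- The ridge function `x ↦ g (s · ℓ x + b)`. -/
def ridge (g : C(ℝ, ℝ)) (l : C(K, ℝ)) (s b : ℝ) : C(K, ℝ) :=
  ⟨fun x => g (s * l x + b), by fun_prop⟩

@[simp]
theorem ridge_apply (g : C(ℝ, ℝ)) (l : C(K, ℝ)) (s b : ℝ) (x : K) :
    ridge g l s b x = g (s * l x + b) := rfl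

theorem continuous_ridge (g : C(ℝ, ℝ)) (l : C(K, ℝ)) {T : Type*} [TopologicalSpace T]
    {s b : T → ℝ} (hs : Continuous s) (hb : Continuous b) :
    Continuous fun t => ridge g l (s t) (b t) :=
  ContinuousMap.continuous_of_continuous_uncurry _
    (by simp only [Function.uncurry_def, ridge_apply]; fun_prop)

variable [CompactSpace K]

/-- A closed space of continuous functions that contains all ridge functions with profile `φ`
contains those whose profile is a mollification of `φ`. -/
theorem ridge_convolution_mem {V : Submodule ℝ C(K, ℝ)} (hV : IsClosed (V : Set C(K, ℝ)))
    {φ : C(ℝ, ℝ)} {l : C(K, ℝ)} (h : ∀ s b, ridge φ l s b ∈ V) (ψ : ContDiffBump (0 : ℝ))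
    {g : C(ℝ, ℝ)}
    (hg : ⇑g = (ψ.normed volume ⋆[ContinuousLinearMap.lsmul ℝ ℝ, volume] φ)) (s b : ℝ) :
    ridge g l s b ∈ V := by
  let F : ℝ → C(K, ℝ) := fun t => ψ.normed volume t • ridge φ l s (b - t)
  have hFc : Continuous F :=
    ψ.continuous_normed.smul (continuous_ridge φ l continuous_const (by fun_prop))
  have hF : Integrable F :=
    hFc.integrable_of_hasCompactSupport ψ.hasCompactSupport_normed.smul_right
  have key : ridge g l s b = ∫ t, F t := by
    ext x
    refine Eq.trans ?_ ((ContinuousMap.evalCLM ℝ x).integral_comp_comm hF)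
    rw [ridge_apply, hg, convolution_def]
    refine integral_congr_ae (Eventually.of_forall fun t => ?_)
    simp [F, add_sub_assoc]
  rw [key]
  exact integral_mem_of_forall_mem hV hFc hF fun t => V.smul_mem _ (h _ _)

/-- Differentiating ridge functions with respect to the slope stays in a closed subspace. -/
theorem mul_ridge_deriv_mem {V : Submodule ℝ C(K, ℝ)} (hV : IsClosed (V : Set C(K, ℝ)))
    {u l : C(K, ℝ)} {g g' : C(ℝ, ℝ)} (hg : ∀ x, HasDerivAt g (g' x) x)
    (h : ∀ s b, u * ridge g l s b ∈ V) (s b : ℝ) : (u * l) * ridge g' l s b ∈ V := by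
  let γ : ℝ → C(K, ℝ) := fun s => (u * l) * ridge g' l s b
  have hγ : Continuous γ :=
    continuous_const.mul (continuous_ridge g' l continuous_id continuous_const)
  -- the fundamental theorem of calculus, with values in `C(K, ℝ)`
  have hint : ∀ s, u * ridge g l s b - u * ridge g l 0 b = ∫ t in (0 : ℝ)..s, γ t := by
    intro s
    ext x
    have h2 := (ContinuousMap.evalCLM ℝ x).intervalIntegral_comp_comm
      (hγ.intervalIntegrable (μ := volume) 0 s)
    refine Eq.trans ?_ h2
    have hd : ∀ t, HasDerivAt (fun t => u x * g (t * l x + b)) (γ t x) t := by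
      intro t
      have h1 : HasDerivAt (fun t => t * l x + b) (l x) t := by
        simpa using ((hasDerivAt_id t).mul_const (l x)).add_const b
      refine (((hg (t * l x + b)).comp t h1).const_mul (u x)).congr_deriv ?_
      change _ = u x * l x * g' (t * l x + b)
      ring
    refine (intervalIntegral.integral_eq_sub_of_hasDerivAt (fun t _ => hd t) ?_).symm
    exact Continuous.intervalIntegrable (((ContinuousMap.evalCLM ℝ x).continuous).comp hγ) 0 s
  have hder : HasDerivAt (fun s => ∫ t in (0 : ℝ)..s, γ t) (γ s) s :=
    intervalIntegral.integral_hasDerivAt_right (hγ.intervalIntegrable 0 s)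
      (hγ.stronglyMeasurableAtFilter _ _) hγ.continuousAt
  refine hV.mem_of_tendsto (hasDerivAt_iff_tendsto_slope.1 hder) (Eventually.of_forall fun t => ?_)
  rw [slope_def_module]
  refine V.smul_mem _ (V.sub_mem ?_ ?_) <;> rw [← hint] <;> exact V.sub_mem (h _ _) (h _ _)

/-- The `m`-th derivative of a ridge function with respect to the slope. -/
theorem pow_mul_ridge_iteratedDeriv_mem {V : Submodule ℝ C(K, ℝ)} (hV : IsClosed (V : Set C(K, ℝ)))
    {l : C(K, ℝ)} {g : C(ℝ, ℝ)} (hg : ContDiff ℝ ∞ g) (h : ∀ s b, ridge g l s b ∈ V) (m : ℕ)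
    (s b : ℝ) :
    l ^ m * ridge ⟨iteratedDeriv m g, hg.continuous_iteratedDeriv m (by exact_mod_cast le_top)⟩
      l s b ∈ V := by
  induction m generalizing s b with
  | zero =>
    rw [pow_zero, one_mul]
    convert h s b using 2
    ext x
    simp
  | succ m ih =>
    rw [pow_succ]
    refine mul_ridge_deriv_mem hV (fun x => ?_) ih s b
    have hd : Differentiable ℝ (iteratedDeriv m g) :=
      hg.differentiable_iteratedDeriv m (by exact_mod_cast WithTop.coe_lt_top m)
    simpa [iteratedDeriv_succ] using (hd x).hasDerivAt

/-- A closed space that contains all ridge functions along `l` with a non-polynomial profile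
contains all powers of `l`: they arise as the slope derivatives, at slope `0`, of ridge functions
with a mollified profile. -/
theorem pow_mem_of_ridge_mem {V : Submodule ℝ C(K, ℝ)} (hV : IsClosed (V : Set C(K, ℝ)))
    {φ : C(ℝ, ℝ)} (hφ_poly : ¬ ∃ p : Polynomial ℝ, ∀ x, φ x = p.eval x) {l : C(K, ℝ)}
    (h : ∀ s b, ridge φ l s b ∈ V) (m : ℕ) : l ^ m ∈ V := by
  obtain ⟨ψ, b, hb⟩ := exists_mollifier_iteratedDeriv_ne_zero φ.continuous hφ_poly m
  have hsmooth : ContDiff ℝ ∞ (ψ.normed volume ⋆[ContinuousLinearMap.lsmul ℝ ℝ, volume] φ) :=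
    ψ.hasCompactSupport_normed.contDiff_convolution_left _ ψ.contDiff_normed
      φ.continuous.locallyIntegrable
  have hmem := pow_mul_ridge_iteratedDeriv_mem (g := ⟨_, hsmooth.continuous⟩) hV hsmooth
    (ridge_convolution_mem hV h ψ rfl) m 0 b
  refine (V.smul_mem_iff hb).1 ?_
  convert hmem using 1
  ext x
  simp [mul_comm]

theorem exp_mem_of_ridge_mem {V : Submodule ℝ C(K, ℝ)} (hV : IsClosed (V : Set C(K, ℝ)))
    {φ : C(ℝ, ℝ)} (hφ_poly : ¬ ∃ p : Polynomial ℝ, ∀ x, φ x = p.eval x) {l : C(K, ℝ)}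
    (h : ∀ s b, ridge φ l s b ∈ V) : NormedSpace.exp l ∈ V :=
  hV.mem_of_tendsto (NormedSpace.exp_series_hasSum_exp' (𝕂 := ℝ) l)
    (Eventually.of_forall fun _ => V.sum_mem fun m _ =>
      V.smul_mem _ (pow_mem_of_ridge_mem hV hφ_poly h m))

theorem exp_continuousMap_apply (l : C(K, ℝ)) (x : K) :
    NormedSpace.exp l x = Real.exp (l x) := by
  rw [Real.exp_eq_exp_ℝ]
  exact NormedSpace.map_exp (ContinuousMap.evalAlgHom ℝ ℝ x)
    (ContinuousMap.evalCLM ℝ x).continuous l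

/-- Ridge functions along a point-separating linear space `Λ`, with non-polynomial profile, are
total in `C(K, ℝ)`: their closed span contains the algebra spanned by the `exp l`, `l ∈ Λ`, to
which the Stone-Weierstrass theorem applies. -/
theorem eq_top_of_ridge_mem_of_separates {φ : C(ℝ, ℝ)}
    (hφ_poly : ¬ ∃ p : Polynomial ℝ, ∀ x, φ x = p.eval x)
    {V : Submodule ℝ C(K, ℝ)} (hV : IsClosed (V : Set C(K, ℝ))) (Λ : Submodule ℝ C(K, ℝ))
    (h : ∀ l ∈ Λ, ∀ b, ridge φ l 1 b ∈ V) (hΛ : ∀ x y, (∀ l ∈ Λ, l x = l y) → x = y) :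
    V = ⊤ := by
  let M : Submonoid C(K, ℝ) :=
    { carrier := {u | ∃ l ∈ Λ, u = NormedSpace.exp l}
      one_mem' := ⟨0, Λ.zero_mem, NormedSpace.exp_zero.symm⟩
      mul_mem' := by
        rintro _ _ ⟨l, hl, rfl⟩ ⟨l', hl', rfl⟩
        exact ⟨l + l', Λ.add_mem hl hl', NormedSpace.exp_add.symm⟩ }
  have hMV : ∀ u ∈ Algebra.adjoin ℝ (M : Set C(K, ℝ)), u ∈ V := by
    intro u hu
    rw [← Subalgebra.mem_toSubmodule, Algebra.adjoin_eq_span, Submonoid.closure_eq] at hu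
    refine Submodule.span_le.2 ?_ hu
    rintro _ ⟨l, hl, rfl⟩
    refine exp_mem_of_ridge_mem hV hφ_poly fun s b => ?_
    convert h (s • l) (Λ.smul_mem s hl) b using 1
    ext x
    simp
  have hsep : (Algebra.adjoin ℝ (M : Set C(K, ℝ))).SeparatesPoints := by
    intro x y hxy
    by_contra! hcon
    refine hxy (hΛ x y fun l hl => ?_)
    have : NormedSpace.exp l x = NormedSpace.exp l y :=
      hcon _ ⟨NormedSpace.exp l, Algebra.subset_adjoin ⟨l, hl, rfl⟩, rfl⟩
    rw [exp_continuousMap_apply, exp_continuousMap_apply] at this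
    exact Real.exp_injective this
  refine eq_top_iff.2 fun f _ => ?_
  have hf : f ∈ (Algebra.adjoin ℝ (M : Set C(K, ℝ))).topologicalClosure := by
    rw [ContinuousMap.subalgebra_topologicalClosure_eq_top_of_separatesPoints _ hsep]
    trivial
  exact closure_minimal hMV hV hf

/-- Without separation of points, the closed span of the ridge functions along `Λ` contains every
continuous function that is constant on the common fibres of `Λ`. -/
theorem mem_of_ridge_mem {φ : C(ℝ, ℝ)} (hφ_poly : ¬ ∃ p : Polynomial ℝ, ∀ x, φ x = p.eval x)
    {V : Submodule ℝ C(K, ℝ)} (hV : IsClosed (V : Set C(K, ℝ))) (Λ : Submodule ℝ C(K, ℝ))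
    (h : ∀ l ∈ Λ, ∀ b, ridge φ l 1 b ∈ V) (f : C(K, ℝ))
    (hf : ∀ x y, (∀ l ∈ Λ, l x = l y) → f x = f y) : f ∈ V := by
  let r : Setoid K :=
    ⟨fun x y => ∀ l ∈ Λ, l x = l y, fun _ _ _ => rfl, fun h l hl => (h l hl).symm,
      fun h h' l hl => (h l hl).trans (h' l hl)⟩
  let π : C(K, Quotient r) := ⟨Quotient.mk r, continuous_quotient_mk'⟩
  let pull : C(Quotient r, ℝ) →ₐ[ℝ] C(K, ℝ) := ContinuousMap.compRightAlgHom ℝ ℝ π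
  have hpull : Continuous pull := ContinuousMap.compRightAlgHom_continuous ℝ ℝ π
  let desc : (g : C(K, ℝ)) → (∀ x y, r x y → g x = g y) → C(Quotient r, ℝ) :=
    fun g hg => ⟨Quotient.lift g hg, g.continuous.quotient_lift hg⟩
  have htop : V.comap pull.toLinearMap = ⊤ := by
    refine eq_top_of_ridge_mem_of_separates hφ_poly (hV.preimage hpull) (Λ.comap pull.toLinearMap)
      (fun l hl b => h _ hl b) ?_
    intro x y
    induction x, y using Quotient.inductionOn₂ with
    | _ x y =>
      intro hxy
      exact Quotient.sound fun l hl => hxy (desc l fun _ _ h => h l hl) hl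
  have : desc f hf ∈ V.comap pull.toLinearMap := htop ▸ Submodule.mem_top
  exact this

end UniversalApproximation

namespace GraphTransformer

/-! ### Transformers that ignore attention -/

/-- Channels of a token without type identifier: tensor features and `k` node identifiers. -/
abbrev TokenIndex (k d dp : ℕ) : Type := Fin d ⊕ (Fin k × Fin dp) ⊕ Fin 0

/-- The augmented token without type identifier. -/
abbrev token {n k d dp : ℕ} (X : Tensor n k (Fin d)) (P : Matrix (Fin n) (Fin dp) ℝ)
    (i : Fin k → Fin n) : TokenIndex k d dp → ℝ :=
  augment X P (fun _ => 0) i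

/-- Attention with vanishing value and output matrices contributes nothing. -/
theorem msa_eq_zero {D H : ℕ} {ι : Type} [Fintype ι] (X : Matrix ι (Fin D) ℝ) :
    msa (fun _ : Fin H => (⟨0, 0, 0, 0, 0, 0⟩ : AttentionHead D 1 1)) X = 0 := by
  ext i c
  simp [msa]

/-- A one-layer Transformer whose attention heads write nothing computes a perceptron of
sum-pooled perceptrons of the tokens. The working dimension has a block for a copy of the token,
read by the hidden units `u`, and a block of initially empty channels, one for each `u`, which the
residual layer fills. -/
theorem exists_transformer_eval_eq (φ : ℝ → ℝ) {n k d dp F J : ℕ}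
    (w : Fin F → TokenIndex k d dp → ℝ) (b : Fin F → ℝ)
    (a : Fin F → Fin J → ℝ) (β c : Fin J → ℝ) :
    ∃ N : Transformer n k d dp, ∀ X P, N.eval φ X P =
      ∑ j, c j * φ (∑ u, a u j * (∑ i, φ (token X P i ⬝ᵥ w u + b u)) + β j) := by
  let e := (Fintype.equivFin (TokenIndex k d dp ⊕ Fin F)).symm
  let layer : TransformerLayer (Fintype.card (TokenIndex k d dp ⊕ Fin F))
      1 1 1 F :=
    { heads := fun _ => ⟨0, 0, 0, 0, 0, 0⟩
      mlp :=
        { W₁ := fun x u => Sum.elim (w u) 0 (e x)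
          b₁ := b
          W₂ := fun u x => Sum.elim 0 (fun u' => if u = u' then 1 else 0) (e x)
          b₂ := 0 } }
  let N : Transformer n k d dp :=
    { de := 0
      dT := _
      H := 1
      dH := 1
      dv := 1
      dF := F
      dOut := J
      H_pos := one_pos
      dH_pos := one_pos
      E := fun _ => 0
      wIn := fun c x => Sum.elim (fun c' => if c = c' then 1 else 0) 0 (e x)
      layers := [layer]
      layers_ne := List.cons_ne_nil _ _
      readout :=
        { W₁ := fun x j => Sum.elim 0 (fun u => a u j) (e x)
          b₁ := β
          W₂ := fun j _ => c j
          b₂ := 0 } }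
  refine ⟨N, fun X P => ?_⟩
  have hin : ∀ i x, (augment X P N.E * N.wIn) i x = Sum.elim (token X P i) 0 (e x) := by
    intro i x
    rw [Matrix.mul_apply]
    change ∑ c, token X P i c * Sum.elim (fun c' => if c = c' then (1 : ℝ) else 0) 0 (e x) = _
    cases e x <;> simp
  have hlayer : ∀ i x, layer.eval φ (augment X P N.E * N.wIn) i x =
      Sum.elim (token X P i) (fun u => φ (token X P i ⬝ᵥ w u + b u)) (e x) := by
    intro i x
    have hpre : ∀ u, ((augment X P N.E * N.wIn) i ᵥ* layer.mlp.W₁ + layer.mlp.b₁) u =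
        token X P i ⬝ᵥ w u + b u := by
      intro u
      rw [Pi.add_apply, Matrix.vecMul, dotProduct]
      simp only [hin]
      change ∑ x, Sum.elim (token X P i) 0 (e x) * Sum.elim (w u) 0 (e x) + b u = _
      rw [e.sum_comp (fun y => Sum.elim (token X P i) 0 y * Sum.elim (w u) 0 y)]
      simp [Fintype.sum_sum_type, dotProduct]
    rw [TransformerLayer.eval, show layer.heads = fun _ => ⟨0, 0, 0, 0, 0, 0⟩ from rfl, msa_eq_zero,
      add_zero, Pi.add_apply, hin, MLP.eval]
    simp only [hpre]
    rw [Pi.add_apply, Matrix.vecMul, dotProduct]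
    change _ + (∑ u, φ _ *
      Sum.elim (0 : TokenIndex k d dp → ℝ) (fun u' => if u = u' then 1 else 0) (e x) + 0) = _
    cases e x <;> simp
  have hpool : ∀ x, (∑ i, N.layers.foldl (fun Z L => L.eval φ Z) (augment X P N.E * N.wIn) i) x =
      ∑ i, Sum.elim (token X P i) (fun u => φ (token X P i ⬝ᵥ w u + b u)) (e x) := by
    intro x
    refine (Finset.sum_apply _ _ _).trans ?_
    exact Finset.sum_congr rfl fun i _ => hlayer i x
  rw [Transformer.eval, MLP.eval, Pi.add_apply, Matrix.vecMul, dotProduct]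
  refine (add_zero _).trans (Finset.sum_congr rfl fun j _ => ?_)
  change φ (_ + β j) * c j = _
  rw [mul_comm, Matrix.vecMul, dotProduct]
  simp only [hpool]
  congr 3
  change ∑ x, (∑ i, Sum.elim (token X P i) _ (e x)) *
    Sum.elim (0 : TokenIndex k d dp → ℝ) (fun u => a u j) (e x) = _
  rw [e.sum_comp (fun y => (∑ i, Sum.elim (token X P i)
    (fun u => φ (token X P i ⬝ᵥ w u + b u)) y) *
      Sum.elim (0 : TokenIndex k d dp → ℝ) (fun u => a u j) y)]
  simp [Fintype.sum_sum_type, mul_comm]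

/-! ### The multiset of tokens determines the orbit of the tensor -/

theorem IsNodeIdentifier.injective {n dp : ℕ} {P : Matrix (Fin n) (Fin dp) ℝ}
    (hP : IsNodeIdentifier P) : Function.Injective P := by
  intro u v huv
  by_contra hne
  have h1 : (P * Pᵀ) u u = (P * Pᵀ) u v := by
    simp only [Matrix.mul_apply, Matrix.transpose_apply, huv]
  rw [IsNodeIdentifier] at hP
  rw [hP, Matrix.one_apply_eq, Matrix.one_apply_ne hne] at h1
  exact one_ne_zero h1

/-- If two tensors with node identifiers have the same multiset of tokens, matching the node
identifiers gives a permutation that carries one tensor to the other. -/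
theorem tensorIso_of_token_sum_eq {n k d dp : ℕ} (hk : 0 < k) {X Y : Tensor n k (Fin d)}
    {P Q : Matrix (Fin n) (Fin dp) ℝ} (hP : IsNodeIdentifier P)
    (hQ : IsNodeIdentifier Q)
    (h : ∀ g : (TokenIndex k d dp → ℝ) → ℝ,
      ∑ i, g (token X P i) = ∑ i, g (token Y Q i)) : TensorIso X Y := by
  classical
  -- every token of `(X, P)` occurs among those of `(Y, Q)`, by testing with its indicator
  have hex : ∀ i, ∃ i', token Y Q i' = token X P i := by
    intro i
    by_contra! hne
    have := h fun t => if t = token X P i then 1 else 0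
    rw [Finset.sum_eq_zero (s := Finset.univ) (f := fun i' => if token Y Q i' = token X P i then
      (1 : ℝ) else 0) fun i' _ => if_neg (hne i')] at this
    have h0 := (Finset.sum_eq_zero_iff_of_nonneg fun i' _ => by positivity).1 this i
      (Finset.mem_univ i)
    simp at h0
  choose σ hσ using hex
  have hX : ∀ i, Y (σ i) = X i := fun i => funext fun c => congrFun (hσ i) (Sum.inl c)
  have hPQ : ∀ i q, Q (σ i q) = P (i q) := fun i q =>
    funext fun c => congrFun (hσ i) (Sum.inr (Sum.inl (q, c)))
  let τ : Fin n → Fin n := fun v => σ (fun _ => v) ⟨0, hk⟩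
  have hQτ : ∀ v, Q (τ v) = P v := fun v => hPQ _ _
  have hτ : Function.Injective τ := fun u v huv => hP.injective (by rw [← hQτ, huv, hQτ])
  have hστ : ∀ i q, σ i q = τ (i q) := fun i q => hQ.injective (by rw [hPQ, hQτ])
  let π : Equiv.Perm (Fin n) := Equiv.ofBijective τ (Finite.injective_iff_bijective.1 hτ)
  refine ⟨π, funext fun i => ?_⟩
  have hi : σ (fun q => π.symm (i q)) = i :=
    funext fun q => (hστ _ q).trans (π.apply_symm_apply (i q))
  rw [permute, ← hX, hi]

/-! ### Universality for invariant functions -/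

section Universality

/-- The set of all node identifiers, a Stiefel manifold. -/
abbrev NodeIdentifier (n dp : ℕ) : Type := {P : Matrix (Fin n) (Fin dp) ℝ // IsNodeIdentifier P}

instance (n dp : ℕ) : CompactSpace (NodeIdentifier n dp) := by
  refine isCompact_iff_compactSpace (s := {P : Matrix (Fin n) (Fin dp) ℝ | IsNodeIdentifier P}).1 ?_
  refine (isCompact_univ_pi fun _ : Fin n => isCompact_univ_pi fun _ : Fin dp =>
    (isCompact_Icc (a := (-1 : ℝ)) (b := 1))).of_isClosed_subset ?_ ?_
  · exact isClosed_eq (by fun_prop) continuous_const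
  · intro (P : Matrix (Fin n) (Fin dp) ℝ) hP v _ c _
    have h1 : (P * Pᵀ) v v = 1 := by
      rw [show P * Pᵀ = 1 from hP, Matrix.one_apply_eq]
    rw [Matrix.mul_apply] at h1
    have h2 : P v c * P v c ≤ 1 := h1 ▸
      Finset.single_le_sum (f := fun c => P v c * P v c) (fun c _ => mul_self_nonneg _)
        (Finset.mem_univ c)
    exact abs_le.1 (abs_le_one_iff_mul_self_le_one.2 h2)

variable {n k d dp : ℕ} {K : Type*} [TopologicalSpace K] (X : C(K, Tensor n k (Fin d)))

theorem continuous_token (i : Fin k → Fin n) :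
    Continuous fun z : K × NodeIdentifier n dp => token (X z.1) z.2.1 i := by
  refine continuous_pi fun c => ?_
  rcases c with c | ⟨q, c⟩ | c
  · change Continuous fun z : K × NodeIdentifier n dp => X z.1 i c
    fun_prop
  · change Continuous fun z : K × NodeIdentifier n dp => z.2.1 (i q) c
    have : Continuous fun z : K × NodeIdentifier n dp => z.2.1 :=
      continuous_subtype_val.comp continuous_snd
    exact this.matrix_elem _ _
  · exact c.elim0

/-- A hidden unit applied to every token and summed over all tokens. -/
def pooledUnit (φ : C(ℝ, ℝ)) (q : (TokenIndex k d dp → ℝ) × ℝ) :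
    C(K × NodeIdentifier n dp, ℝ) :=
  ⟨fun z => ∑ i, φ (token (X z.1) z.2.1 i ⬝ᵥ q.1 + q.2),
    continuous_finsetSum _ fun i _ => φ.continuous.comp
      (((continuous_token X i).dotProduct continuous_const).add continuous_const)⟩

/-- Finitely many vectors in a span are combinations of a common finite list of generators. -/
theorem exists_common_generators {E ι : Type*} [AddCommGroup E] [Module ℝ E] (v : ι → E) {J : ℕ}
    (x : Fin J → E) (hx : ∀ j, x j ∈ Submodule.span ℝ (Set.range v)) :
    ∃ (F : ℕ) (q : Fin F → ι) (a : Fin F → Fin J → ℝ), ∀ j, x j = ∑ u, a u j • v (q u) := by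
  choose c hc using fun j => Finsupp.mem_span_range_iff_exists_finsupp.1 (hx j)
  classical
  let s : Finset ι := Finset.univ.biUnion fun j => (c j).support
  refine ⟨s.card, fun u => s.equivFin.symm u, fun u j => c j (s.equivFin.symm u), fun j => ?_⟩
  rw [s.equivFin.symm.sum_comp fun i : s => c j i • v i, ← hc j,
    Finset.sum_coe_sort s fun i => c j i • v i]
  exact Finset.sum_subset (Finset.subset_biUnion_of_mem (fun j => (c j).support)
    (Finset.mem_univ j)) fun i _ hi => by
      simp only [Finsupp.notMem_support_iff.1 hi, zero_smul]

/-- The pooled hidden units detect the multiset of tokens: on the finite set of tokens of two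
inputs every function is a combination of hidden units. -/
theorem token_sum_eq_of_pooledUnit_eq {φ : C(ℝ, ℝ)}
    (hφ_poly : ¬ ∃ p : Polynomial ℝ, ∀ x, φ x = p.eval x) (z z' : K × NodeIdentifier n dp)
    (h : ∀ q, pooledUnit X φ q z = pooledUnit X φ q z')
    (g : (TokenIndex k d dp → ℝ) → ℝ) :
    ∑ i, g (token (X z.1) z.2.1 i) = ∑ i, g (token (X z'.1) z'.2.1 i) := by
  let τ : (Fin k → Fin n) → _ := token (X z.1) z.2.1
  let τ' : (Fin k → Fin n) → _ := token (X z'.1) z'.2.1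
  let S : Set (TokenIndex k d dp → ℝ) := Set.range τ ∪ Set.range τ'
  have : Finite S := ((Set.finite_range τ).union (Set.finite_range τ')).to_subtype
  let t : (Fin k → Fin n) → S := fun i => ⟨τ i, Or.inl ⟨i, rfl⟩⟩
  let t' : (Fin k → Fin n) → S := fun i => ⟨τ' i, Or.inr ⟨i, rfl⟩⟩
  let ev : S → C(S, ℝ) →L[ℝ] ℝ := fun s => ContinuousMap.evalCLM ℝ s
  let D : C(S, ℝ) →L[ℝ] ℝ := ∑ i, ev (t i) - ∑ i, ev (t' i)
  have hD : ∀ u, D u = ∑ i, u (t i) - ∑ i, u (t' i) := fun u => by simp [D, ev]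
  let lin : (TokenIndex k d dp → ℝ) →ₗ[ℝ] C(S, ℝ) :=
    { toFun := fun w => ⟨fun s => s.1 ⬝ᵥ w, by fun_prop⟩
      map_add' := fun w w' => by ext s; exact dotProduct_add _ _ _
      map_smul' := fun r w => by ext s; exact dotProduct_smul _ _ _ }
  have hmem : (⟨fun s => g s.1, continuous_of_discreteTopology⟩ : C(S, ℝ)) ∈
      D.toLinearMap.ker := by
    refine mem_of_ridge_mem hφ_poly D.isClosed_ker (LinearMap.range lin) ?_ _ ?_
    · rintro _ ⟨w, rfl⟩ b
      refine (hD _).trans (sub_eq_zero.2 ?_)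
      simp only [ridge_apply, one_mul]
      exact h (w, b)
    · intro x y hxy
      have : x = y := Subtype.ext (funext fun c => by
        simpa [lin] using hxy _ ⟨Pi.single c 1, rfl⟩)
      rw [this]
  exact sub_eq_zero.1 ((hD _).symm.trans hmem)

variable [CompactSpace K]

/-- **Universality.** Transformers approximate every continuous function of order-`k` tensors that
is constant on orbits, uniformly over a compact family of tensors and all node identifiers. -/
theorem exists_transformer_approx {φ : ℝ → ℝ} (hφ : Continuous φ)
    (hφ_poly : ¬ ∃ p : Polynomial ℝ, ∀ x, φ x = p.eval x) (hk : 0 < k) (f : C(K, ℝ))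
    (hf : ∀ x y, TensorIso (X x) (X y) → f x = f y) {ε : ℝ} (hε : 0 < ε) :
    ∃ N : Transformer n k d dp, ∀ x (P : Matrix (Fin n) (Fin dp) ℝ), IsNodeIdentifier P →
      |N.eval φ (X x) P - f x| ≤ ε := by
  let Φ : C(ℝ, ℝ) := ⟨φ, hφ⟩
  let Λ : Submodule ℝ C(K × NodeIdentifier n dp, ℝ) :=
    Submodule.span ℝ (Set.range (pooledUnit X Φ))
  let V₀ : Submodule ℝ C(K × NodeIdentifier n dp, ℝ) :=
    Submodule.span ℝ (Set.range fun p : Λ × ℝ => ridge Φ p.1.1 1 p.2)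
  have hmem : f.comp ContinuousMap.fst ∈ V₀.topologicalClosure := by
    refine mem_of_ridge_mem (φ := Φ) hφ_poly V₀.isClosed_topologicalClosure Λ
      (fun l hl b => V₀.le_topologicalClosure (Submodule.subset_span ⟨(⟨l, hl⟩, b), rfl⟩)) _ ?_
    intro z z' hz
    exact hf _ _ (tensorIso_of_token_sum_eq hk z.2.2 z'.2.2
      (token_sum_eq_of_pooledUnit_eq X (φ := Φ) hφ_poly z z'
        fun q => hz _ (Submodule.subset_span ⟨q, rfl⟩)))
  obtain ⟨g, hg, hgf⟩ := Metric.mem_closure_iff.1 hmem ε hε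
  obtain ⟨J, p, c, hgJ⟩ := exists_common_generators _ (fun _ : Fin 1 => g) fun _ => hg
  obtain ⟨F, q, a, ha⟩ := exists_common_generators _ (fun j => (p j).1.1) fun j => (p j).1.2
  obtain ⟨N, hN⟩ := exists_transformer_eval_eq φ (n := n) (fun u => (q u).1) (fun u => (q u).2) a
    (fun j => (p j).2) (fun j => c j 0)
  refine ⟨N, fun x P hP => ?_⟩
  have hgN : N.eval φ (X x) P = g (x, ⟨P, hP⟩) := by
    rw [hN, hgJ 0]
    simp only [ContinuousMap.coe_sum, Finset.sum_apply, ContinuousMap.coe_smul, Pi.smul_apply,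
      smul_eq_mul, ridge_apply, one_mul, ha]
    rfl
  rw [hgN, ← Real.dist_eq, dist_comm]
  exact (ContinuousMap.dist_apply_le_dist (f := f.comp ContinuousMap.fst) (g := g)
    (x, ⟨P, hP⟩)).trans hgf.le

end Universality

/-! ### Invariance of the Weisfeiler-Leman test -/

theorem permute_symm_permute {n k : ℕ} {δ : Type} (π : Equiv.Perm (Fin n)) (X : Tensor n k δ) :
    permute π.symm (permute π X) = X := by
  funext i
  simp [permute]

theorem permute_pair {n : ℕ} {δ : Type} (π : Equiv.Perm (Fin n)) (A : Tensor n 2 δ)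
    (u v : Fin n) : permute π A ![u, v] = A ![π.symm u, π.symm v] := by
  refine congrArg A (funext fun q => ?_)
  fin_cases q <;> rfl

theorem TensorIso.equivalence (n k : ℕ) (δ : Type) :
    Equivalence (TensorIso : Tensor n k δ → Tensor n k δ → Prop) where
  refl _ := ⟨1, rfl⟩
  symm := by
    rintro X _ ⟨π, rfl⟩
    exact ⟨π.symm, (permute_symm_permute π X).symm⟩
  trans := by
    rintro X _ _ ⟨π, rfl⟩ ⟨σ, rfl⟩
    exact ⟨σ * π, rfl⟩

theorem wlColor_permute (k : ℕ) {n : ℕ} {δ : Type} (π : Equiv.Perm (Fin n)) (A : Tensor n 2 δ)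
    (t : ℕ) (i : Fin k → Fin n) :
    wlColor k (permute π A) t i = wlColor k A t (fun a => π.symm (i a)) := by
  induction t generalizing i with
  | zero =>
    funext a b
    refine Prod.ext (propext π.symm.injective.eq_iff.symm) ?_
    exact permute_pair π A (i a) (i b)
  | succ t ih =>
    refine Prod.ext (ih i) (funext fun a => ?_)
    -- the replacing node `v` runs over all nodes, so `v` may be renamed to `π.symm v`
    have huniv : (Finset.univ.val : Multiset (Fin n)).map π.symm = Finset.univ.val :=
      Multiset.map_univ_val_equiv π.symm
    change (Finset.univ.val : Multiset (Fin n)).map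
        (fun v => wlColor k (permute π A) t (Function.update i a v)) =
      (Finset.univ.val : Multiset (Fin n)).map
        (fun v => wlColor k A t (Function.update (fun a => π.symm (i a)) a v))
    conv_rhs => rw [← huniv, Multiset.map_map]
    refine Multiset.map_congr rfl fun v _ => ?_
    rw [ih]
    congr 1
    exact Function.comp_update π.symm i a v

theorem TensorIso.not_wlDistinguishes (k : ℕ) {n : ℕ} {δ : Type} {A B : Tensor n 2 δ}
    (h : TensorIso A B) : ¬ WLDistinguishes k A B := by
  obtain ⟨π, rfl⟩ := h
  rintro ⟨t, ht⟩
  refine ht ?_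
  have huniv := Multiset.map_univ_val_equiv (Equiv.arrowCongr (Equiv.refl (Fin k)) π.symm)
  conv_lhs => rw [← huniv, Multiset.map_map]
  refine Multiset.map_congr rfl fun i _ => ?_
  rw [wlColor_permute]
  rfl

/-- Lossless equivariant representations reflect isomorphism. -/
theorem IsTensorRepresentation.tensorIso {n k : ℕ} {δ δ' : Type}
    {rep : Tensor n 2 δ → Tensor n k δ'} (h : IsTensorRepresentation rep) {A B : Tensor n 2 δ}
    (hAB : TensorIso (rep A) (rep B)) : TensorIso A B := by
  obtain ⟨π, hπ⟩ := hAB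
  exact ⟨π, h.injective (hπ.trans (h.equivariant π A).symm)⟩

/-- A single Transformer separates the isomorphism classes of finitely many graphs: it approximates
a function that numbers these classes by even integers. -/
theorem exists_transformer_separating {φ : ℝ → ℝ} (hφ : Continuous φ)
    (hφ_poly : ¬ ∃ p : Polynomial ℝ, ∀ x, φ x = p.eval x) {n k dp d d' : ℕ} (hk : 0 < k)
    {rep : Tensor n 2 (Fin d) → Tensor n k (Fin d')} (hrep : IsTensorRepresentation rep)
    {S : Set (Tensor n 2 (Fin d))} (hS : S.Finite) {ε : ℝ} (hε : 0 < ε) :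
    ∃ N : Transformer n k d' dp, ∀ A ∈ S, ∀ B ∈ S, ∀ P Q : Matrix (Fin n) (Fin dp) ℝ,
      IsNodeIdentifier P → IsNodeIdentifier Q →
        (¬ TensorIso A B → 1 ≤ |N.eval φ (rep A) P - N.eval φ (rep B) Q|) ∧
        (TensorIso A B → |N.eval φ (rep A) P - N.eval φ (rep B) Q| ≤ ε) := by
  let r : Setoid (Tensor n 2 (Fin d)) := ⟨TensorIso, TensorIso.equivalence n 2 (Fin d)⟩
  obtain ⟨ν, hν⟩ := Set.countable_iff_exists_injOn.1 (hS.image (Quotient.mk r)).countable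
  have : Finite S := hS.to_subtype
  let f : C(S, ℝ) := ⟨fun A => 2 * (ν (Quotient.mk r A.1) : ℝ), continuous_of_discreteTopology⟩
  obtain ⟨N, hN⟩ := exists_transformer_approx (dp := dp)
    (X := (⟨fun A => rep A.1, continuous_of_discreteTopology⟩ : C(S, Tensor n k (Fin d')))) hφ
    hφ_poly hk f (fun A B h => by
      have : Quotient.mk r A.1 = Quotient.mk r B.1 := Quotient.sound (hrep.tensorIso h)
      simp only [f, ContinuousMap.coe_mk, this])
    (ε := min ε 1 / 2) (by positivity)
  refine ⟨N, fun A hA B hB P Q hP hQ => ?_⟩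
  have h1 := abs_le.1 (hN ⟨A, hA⟩ P hP)
  have h2 := abs_le.1 (hN ⟨B, hB⟩ Q hQ)
  simp only [f, ContinuousMap.coe_mk] at h1 h2
  have hε1 := min_le_left ε 1
  have hε2 := min_le_right ε 1
  constructor
  · intro hAB
    have hne : ν (Quotient.mk r A) ≠ ν (Quotient.mk r B) := fun h =>
      hAB (Quotient.exact (hν (Set.mem_image_of_mem _ hA) (Set.mem_image_of_mem _ hB) h))
    rcases lt_or_gt_of_ne hne with h | h
    · have h' : (ν (Quotient.mk r A) : ℝ) + 1 ≤ ν (Quotient.mk r B) := by exact_mod_cast h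
      rw [abs_sub_comm]
      exact le_trans (by linarith) (le_abs_self _)
    · have h' : (ν (Quotient.mk r B) : ℝ) + 1 ≤ ν (Quotient.mk r A) := by exact_mod_cast h
      exact le_trans (by linarith) (le_abs_self _)
  · intro hAB
    rw [show Quotient.mk r A = Quotient.mk r B from Quotient.sound hAB] at h1
    exact abs_le.2 ⟨by linarith, by linarith⟩

/-! ### Continuous invariants of graphs -/

/-- Transformers approximate every invariant of featured graphs that extends to a continuous
invariant of order-`2` tensors. -/
theorem transformerApproximates_comp_toTensor {φ : ℝ → ℝ} (hφ : Continuous φ)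
    (hφ_poly : ¬ ∃ p : Polynomial ℝ, ∀ x, φ x = p.eval x) {n k dp c c' d : ℕ} (hk : 0 < k)
    {rep : Tensor n 2 (Unit ⊕ Fin c ⊕ Fin c') → Tensor n k (Fin d)}
    (hrep : IsTensorRepresentation rep) {F : Tensor n 2 (Unit ⊕ Fin c ⊕ Fin c') → ℝ}
    (hF : Continuous F) (hFπ : ∀ π A, F (permute π A) = F A) :
    TransformerApproximates φ dp rep fun G => F G.toTensor := by
  intro r ε hε
  let K : Set (Tensor n 2 (Unit ⊕ Fin c ⊕ Fin c')) :=
    Set.univ.pi fun _ => Set.univ.pi fun _ => Set.Icc (-r) r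
  have : CompactSpace K := isCompact_iff_compactSpace.1
    (isCompact_univ_pi fun _ => isCompact_univ_pi fun _ => isCompact_Icc)
  obtain ⟨N, hN⟩ := exists_transformer_approx (dp := dp)
    (X := (⟨fun A => rep A.1, hrep.continuous.comp continuous_subtype_val⟩ :
      C(K, Tensor n k (Fin d)))) hφ hφ_poly hk
    ⟨fun A => F A.1, hF.comp continuous_subtype_val⟩ (fun A B h => by
      obtain ⟨π, hπ⟩ := hrep.tensorIso h
      change F A.1 = F B.1
      rw [hπ, hFπ]) hε
  exact ⟨N, fun G hG P hP =>
    hN ⟨G.toTensor, fun i _ a _ => abs_le.1 (hG i a)⟩ P hP⟩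

theorem FeaturedGraph.toTensor_relabel {n c c' : ℕ} (π : Equiv.Perm (Fin n))
    (G : FeaturedGraph n c c') : (G.relabel π).toTensor = permute π G.toTensor := by
  funext i a
  rcases a with _ | a | a
  · rfl
  · simp [toTensor, permute, relabel]
  · rfl

/-! ### Message passing is continuous in the tensor -/

namespace MPNN

variable {n c c' : ℕ} (M : MPNN n c c')

/-- Message passing on an arbitrary order-`2` tensor, with the first channel as edge weights. -/
def tensorState (A : Tensor n 2 (Unit ⊕ Fin c ⊕ Fin c')) : (t : ℕ) → Fin n → Fin (M.hid t) → ℝ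
  | 0 => fun v => M.embed fun a => A ![v, v] (Sum.inr (Sum.inl a))
  | t + 1 => fun v =>
      M.U t (tensorState A t v)
        (∑ w, A ![v, w] (Sum.inl ()) •
          M.M t (tensorState A t v) (tensorState A t w) fun a => A ![v, w] (Sum.inr (Sum.inr a)))

theorem tensorState_toTensor (G : FeaturedGraph n c c') (t : ℕ) :
    M.tensorState G.toTensor t = M.state G t := by
  induction t with
  | zero =>
    funext v
    simp [tensorState, state, FeaturedGraph.toTensor]
  | succ t ih =>
    funext v
    simp only [tensorState, state, ih]
    congr 1
    rw [Finset.sum_filter]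
    refine Finset.sum_congr rfl fun w _ => ?_
    by_cases h : G.graph.Adj v w <;> simp [FeaturedGraph.toTensor, h]

theorem continuous_tensorState (t : ℕ) : Continuous fun A => M.tensorState A t := by
  induction t with
  | zero =>
    refine continuous_pi fun v => M.continuous_embed.comp ?_
    fun_prop
  | succ t ih =>
    have hv : ∀ v, Continuous fun A => M.tensorState A t v := fun v => (continuous_apply v).comp ih
    have hm : ∀ v, Continuous fun A : Tensor n 2 (Unit ⊕ Fin c ⊕ Fin c') =>
        ∑ w, A ![v, w] (Sum.inl ()) •
          M.M t (M.tensorState A t v) (M.tensorState A t w)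
            fun a => A ![v, w] (Sum.inr (Sum.inr a)) := by
      refine fun v => continuous_finsetSum _ fun w _ => ?_
      have hadj : Continuous fun A : Tensor n 2 (Unit ⊕ Fin c ⊕ Fin c') =>
          A ![v, w] (Sum.inl ()) := by fun_prop
      have he : Continuous fun (A : Tensor n 2 (Unit ⊕ Fin c ⊕ Fin c')) (a : Fin c') =>
          A ![v, w] (Sum.inr (Sum.inr a)) := by fun_prop
      exact hadj.smul ((M.continuous_M t).comp ((hv v).prodMk ((hv w).prodMk he)))
    exact continuous_pi fun v => (M.continuous_U t).comp ((hv v).prodMk (hm v))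

theorem tensorState_permute (π : Equiv.Perm (Fin n)) (A : Tensor n 2 (Unit ⊕ Fin c ⊕ Fin c'))
    (t : ℕ) (v : Fin n) : M.tensorState (permute π A) t v = M.tensorState A t (π.symm v) := by
  induction t generalizing v with
  | zero => simp only [tensorState, permute_pair]
  | succ t ih =>
    simp only [tensorState, permute_pair, ih]
    congr 1
    exact π.symm.sum_comp fun w => A ![π.symm v, w] (Sum.inl ()) •
      M.M t (M.tensorState A t (π.symm v)) (M.tensorState A t w)
        fun a => A ![π.symm v, w] (Sum.inr (Sum.inr a))

/-- Transformers approximate every message-passing network. -/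
theorem transformerApproximates_eval {φ : ℝ → ℝ} (hφ : Continuous φ)
    (hφ_poly : ¬ ∃ p : Polynomial ℝ, ∀ x, φ x = p.eval x) {k dp d : ℕ} (hk : 0 < k)
    {rep : Tensor n 2 (Unit ⊕ Fin c ⊕ Fin c') → Tensor n k (Fin d)}
    (hrep : IsTensorRepresentation rep) : TransformerApproximates φ dp rep M.eval := by
  have := transformerApproximates_comp_toTensor (dp := dp) hφ hφ_poly hk hrep
    (F := fun A => M.R (M.tensorState A M.T))
    (M.continuous_R.comp (M.continuous_tensorState M.T)) (fun π A => by
      rw [← M.R_perm π.symm (M.tensorState A M.T)]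
      exact congrArg M.R (funext (M.tensorState_permute π A M.T)))
  simp only [tensorState_toTensor] at this
  exact this

/-- On featureless graphs whose edges join nodes of equal degree, the state of a node only depends
on its degree, in the same way for all such graphs. -/
theorem exists_state_eq_of_degree : ∀ t : ℕ, ∃ s : ℕ → Fin (M.hid t) → ℝ,
    ∀ G : SimpleGraph (Fin n),
      (∀ v w, G.Adj v w → (G.neighborSet v).ncard = (G.neighborSet w).ncard) →
      ∀ v, M.state ⟨G, 0, 0⟩ t v = s (G.neighborSet v).ncard := by
  intro t
  induction t with
  | zero => exact ⟨fun _ => M.embed 0, fun G _ v => rfl⟩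
  | succ t ih =>
    obtain ⟨s, hs⟩ := ih
    refine ⟨fun m => M.U t (s m) (m • M.M t (s m) (s m) 0), fun G hG v => ?_⟩
    classical
    rw [state]
    beta_reduce
    rw [hs G hG v]
    congr 1
    rw [Finset.sum_congr rfl (g := fun _ => M.M t (s (G.neighborSet v).ncard)
      (s (G.neighborSet v).ncard) 0), Finset.sum_const]
    · congr 1
      rw [← Set.ncard_coe_finset]
      congr 1
      ext w
      simp
    · intro w hw
      rw [hs G hG w, ← hG v w (Finset.mem_filter.1 hw).2]
      rfl

theorem eval_eq_of_degree_eq {G G' : SimpleGraph (Fin n)}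
    (hG : ∀ v w, G.Adj v w → (G.neighborSet v).ncard = (G.neighborSet w).ncard)
    (hG' : ∀ v w, G'.Adj v w → (G'.neighborSet v).ncard = (G'.neighborSet w).ncard)
    (h : ∀ v, (G.neighborSet v).ncard = (G'.neighborSet v).ncard) :
    M.eval ⟨G, 0, 0⟩ = M.eval ⟨G', 0, 0⟩ := by
  obtain ⟨s, hs⟩ := M.exists_state_eq_of_degree M.T
  exact congrArg M.R (funext fun v => by rw [hs G hG, hs G' hG', h])

end MPNN

/-! ### Two triangles and a hexagon -/

/-- The hexagon `0 - 1 - ⋯ - 5 - 0`, with all further nodes isolated. -/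
def hexagon (n : ℕ) : SimpleGraph (Fin n) where
  Adj u v := u.1 < 6 ∧ v.1 < 6 ∧ ((u.1 + 1) % 6 = v.1 ∨ (v.1 + 1) % 6 = u.1)
  symm := ⟨fun _ _ h => ⟨h.2.1, h.1, h.2.2.symm⟩⟩
  loopless := ⟨fun _ h => by omega⟩

/-- The disjoint triangles `{0, 1, 2}` and `{3, 4, 5}`, with all further nodes isolated. -/
def twoTriangles (n : ℕ) : SimpleGraph (Fin n) where
  Adj u v := u.1 < 6 ∧ v.1 < 6 ∧ u ≠ v ∧ u.1 / 3 = v.1 / 3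
  symm := ⟨fun _ _ h => ⟨h.2.1, h.1, h.2.2.1.symm, h.2.2.2.symm⟩⟩
  loopless := ⟨fun _ h => h.2.2.1 rfl⟩

theorem ncard_neighborSet_hexagon {n : ℕ} (hn : 6 ≤ n) (v : Fin n) :
    ((hexagon n).neighborSet v).ncard = if v.1 < 6 then 2 else 0 := by
  split_ifs with hv
  · rw [← Set.ncard_pair (a := (⟨(v + 1) % 6, by omega⟩ : Fin n))
      (b := ⟨(v + 5) % 6, by omega⟩) (by rw [Ne, Fin.mk.injEq]; omega)]
    congr 1
    ext w
    simp only [SimpleGraph.mem_neighborSet, hexagon, Set.mem_insert_iff, Set.mem_singleton_iff,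
      Fin.ext_iff]
    omega
  · rw [Set.ncard_eq_zero]
    ext w
    simp [hexagon, hv]

theorem ncard_neighborSet_twoTriangles {n : ℕ} (hn : 6 ≤ n) (v : Fin n) :
    ((twoTriangles n).neighborSet v).ncard = if v.1 < 6 then 2 else 0 := by
  split_ifs with hv
  · rw [← Set.ncard_pair (a := (⟨v / 3 * 3 + (v + 1) % 3, by omega⟩ : Fin n))
      (b := ⟨v / 3 * 3 + (v + 2) % 3, by omega⟩) (by rw [Ne, Fin.mk.injEq]; omega)]
    congr 1
    ext w
    simp only [SimpleGraph.mem_neighborSet, twoTriangles, Set.mem_insert_iff, Set.mem_singleton_iff,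
      Fin.ext_iff, Ne]
    omega
  · rw [Set.ncard_eq_zero]
    ext w
    simp [twoTriangles, hv]

/-- The number of closed walks of length three, as a polynomial in the first channel of an
order-`2` tensor. -/
def closedThreeWalks {n : ℕ} {δ : Type} (A : Tensor n 2 (Unit ⊕ δ)) : ℝ :=
  ∑ u, ∑ v, ∑ w, A ![u, v] (Sum.inl ()) * A ![v, w] (Sum.inl ()) * A ![w, u] (Sum.inl ())

theorem closedThreeWalks_permute {n : ℕ} {δ : Type} (π : Equiv.Perm (Fin n))
    (A : Tensor n 2 (Unit ⊕ δ)) : closedThreeWalks (permute π A) = closedThreeWalks A := by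
  simp only [closedThreeWalks, permute_pair]
  rw [← π.symm.sum_comp fun u => ∑ v, ∑ w,
    A ![u, v] (Sum.inl ()) * A ![v, w] (Sum.inl ()) * A ![w, u] (Sum.inl ())]
  refine Finset.sum_congr rfl fun u _ => ?_
  rw [← π.symm.sum_comp fun v => ∑ w,
    A ![π.symm u, v] (Sum.inl ()) * A ![v, w] (Sum.inl ()) * A ![w, π.symm u] (Sum.inl ())]
  refine Finset.sum_congr rfl fun v _ => ?_
  rw [← π.symm.sum_comp fun w => A ![π.symm u, π.symm v] (Sum.inl ()) *
    A ![π.symm v, w] (Sum.inl ()) * A ![w, π.symm u] (Sum.inl ())]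

theorem closedThreeWalks_hexagon (n c c' : ℕ) :
    closedThreeWalks (FeaturedGraph.toTensor (⟨hexagon n, 0, 0⟩ : FeaturedGraph n c c')) = 0 := by
  refine Finset.sum_eq_zero fun u _ => Finset.sum_eq_zero fun v _ =>
    Finset.sum_eq_zero fun w _ => ?_
  have : ¬ ((hexagon n).Adj u v ∧ (hexagon n).Adj v w ∧ (hexagon n).Adj w u) := by
    simp only [hexagon]
    omega
  by_contra hne
  refine this ⟨?_, ?_, ?_⟩ <;> by_contra h <;> simp [FeaturedGraph.toTensor, h] at hne

theorem closedThreeWalks_twoTriangles_pos {n : ℕ} (hn : 6 ≤ n) (c c' : ℕ) :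
    0 < closedThreeWalks
      (FeaturedGraph.toTensor (⟨twoTriangles n, 0, 0⟩ : FeaturedGraph n c c')) := by
  have hnn : ∀ u v : Fin n, 0 ≤ FeaturedGraph.toTensor
      (⟨twoTriangles n, 0, 0⟩ : FeaturedGraph n c c') ![u, v] (Sum.inl ()) := by
    intro u v
    simp only [FeaturedGraph.toTensor, Sum.elim_inl]
    split_ifs <;> norm_num
  have h3 := fun u v w : Fin n => mul_nonneg (mul_nonneg (hnn u v) (hnn v w)) (hnn w u)
  have h2 := fun u v : Fin n => Finset.sum_nonneg fun w (_ : w ∈ Finset.univ) => h3 u v w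
  have h1 := fun u : Fin n => Finset.sum_nonneg fun v (_ : v ∈ Finset.univ) => h2 u v
  refine Finset.sum_pos' (fun u _ => h1 u) ⟨⟨0, by omega⟩, Finset.mem_univ _, ?_⟩
  refine Finset.sum_pos' (fun v _ => h2 _ v) ⟨⟨1, by omega⟩, Finset.mem_univ _, ?_⟩
  refine Finset.sum_pos' (fun w _ => h3 _ _ w) ⟨⟨2, by omega⟩, Finset.mem_univ _, ?_⟩
  simp [FeaturedGraph.toTensor, twoTriangles]

/-- Every message-passing network confuses the hexagon with two triangles. -/
theorem MPNN.eval_hexagon_eq {n c c' : ℕ} (hn : 6 ≤ n) (M : MPNN n c c') :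
    M.eval ⟨hexagon n, 0, 0⟩ = M.eval ⟨twoTriangles n, 0, 0⟩ := by
  refine M.eval_eq_of_degree_eq (fun v w h => ?_) (fun v w h => ?_) fun v => ?_
  · rw [ncard_neighborSet_hexagon hn, ncard_neighborSet_hexagon hn, if_pos h.1, if_pos h.2.1]
  · rw [ncard_neighborSet_twoTriangles hn, ncard_neighborSet_twoTriangles hn, if_pos h.1,
      if_pos h.2.1]
  · rw [ncard_neighborSet_hexagon hn, ncard_neighborSet_twoTriangles hn]

end GraphTransformer

theorem corollary2 (φ : ℝ → ℝ) (hφ : Continuous φ)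
    (hφ_poly : ¬ ∃ p : Polynomial ℝ, ∀ x, φ x = p.eval x)
    (n k dp : ℕ) (hk : 2 ≤ k) (hdp : n ≤ dp) :
    (∀ (d d' : ℕ)
        (rep : GraphTransformer.Tensor n 2 (Fin d) → GraphTransformer.Tensor n k (Fin d')),
      GraphTransformer.IsTensorRepresentation rep →
      ∀ S : Set (GraphTransformer.Tensor n 2 (Fin d)), S.Finite → ∀ ε : ℝ, 0 < ε →
        ∃ N : GraphTransformer.Transformer n k d' dp, ∀ A ∈ S, ∀ B ∈ S,
          ∀ P Q : Matrix (Fin n) (Fin dp) ℝ,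
            GraphTransformer.IsNodeIdentifier P → GraphTransformer.IsNodeIdentifier Q →
              (GraphTransformer.WLDistinguishes k A B →
                1 ≤ |N.eval φ (rep A) P - N.eval φ (rep B) Q|) ∧
              (GraphTransformer.TensorIso A B →
                |N.eval φ (rep A) P - N.eval φ (rep B) Q| ≤ ε)) ∧
    (∀ (c c' d' : ℕ)
        (rep : GraphTransformer.Tensor n 2 (Unit ⊕ Fin c ⊕ Fin c') →
          GraphTransformer.Tensor n k (Fin d')),
      GraphTransformer.IsTensorRepresentation rep →
        (∀ M : GraphTransformer.MPNN n c c',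
          GraphTransformer.TransformerApproximates φ dp rep M.eval) ∧
        (6 ≤ n → ∃ f : GraphTransformer.FeaturedGraph n c c' → ℝ,
          (∀ (π : Equiv.Perm (Fin n)) (G : GraphTransformer.FeaturedGraph n c c'),
            f (G.relabel π) = f G) ∧
          GraphTransformer.TransformerApproximates φ dp rep f ∧
          ∃ G G' : GraphTransformer.FeaturedGraph n c c', f G ≠ f G' ∧
            ∀ M : GraphTransformer.MPNN n c c', M.eval G = M.eval G')) := by
  have hk0 : 0 < k := by omega
  refine ⟨fun d d' rep hrep S hS ε hε => ?_, fun c c' d' rep hrep =>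
    ⟨fun M => M.transformerApproximates_eval hφ hφ_poly hk0 hrep, fun hn => ?_⟩⟩
  · obtain ⟨N, hN⟩ := GraphTransformer.exists_transformer_separating (dp := dp) hφ hφ_poly hk0 hrep
      hS hε
    refine ⟨N, fun A hA B hB P Q hP hQ => ⟨fun hAB => ?_, (hN A hA B hB P Q hP hQ).2⟩⟩
    exact (hN A hA B hB P Q hP hQ).1 fun h => h.not_wlDistinguishes k hAB
  · refine ⟨fun G => GraphTransformer.closedThreeWalks G.toTensor, fun π G => ?_,
      GraphTransformer.transformerApproximates_comp_toTensor hφ hφ_poly hk0 hrep ?_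
        GraphTransformer.closedThreeWalks_permute,
      ⟨GraphTransformer.hexagon n, 0, 0⟩, ⟨GraphTransformer.twoTriangles n, 0, 0⟩, ?_,
      fun M => M.eval_hexagon_eq hn⟩
    · simp only [GraphTransformer.FeaturedGraph.toTensor_relabel,
        GraphTransformer.closedThreeWalks_permute]
    · unfold GraphTransformer.closedThreeWalks
      fun_prop
    · dsimp only
      rw [GraphTransformer.closedThreeWalks_hexagon]
      exact (GraphTransformer.closedThreeWalks_twoTriangles_pos hn c c').ne
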